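/- Let $k$ be a field and let $\Delta$ be a simplicial complex (a set of subsets of a finite set $A$, closed under taking subsets) with $n$ vertices, where the vertex set is $V(\Delta)=\{v\in A : \{v\}\in\Delta\}$. Let $S=k[x_v : v\in A]$ with the standard grading. For a simplicial complex $\Sigma$ on vertices from $A$, let $I(\Sigma)\subseteq S$ be its facet ideal, generated by the square-free monomials $\prod_{v\in G}x_v$ with $G$ a facet (a maximal face) of $\Sigma$, and let $\beta_{i,j}(\Sigma)=\beta_{i,j}(S/I(\Sigma))$ be the number of summands $S(-j)$ in homological degree $i$ of a minimal graded free resolution of $S/I(\Sigma)$ over $S$ (with $\beta_{i,j}=0$ for $i<0$). Let $F$ be a facet of $\Delta$ that has a free vertex, that is, a vertex belonging to no facet of $\Delta$ other than $F$. Put $\overline F=V(\Delta)\setminus F$, let $\Delta\setminus\langle F\rangle$ be the complex generated by the facets of $\Delta$ other than $F$ (the void complex, with facet ideal $0$, if there are none), and let $\Gamma=(\Delta\setminus\langle F\rangle)_{\overline F}$ be its localization at the prime ideal generated by the variables $x_v$, $v\in\overline F$, i.e. the simplicial complex whose facets are the minimal elements under inclusion among the sets $G\cap\overline F=G\setminus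 F$, where $G$ runs over the facets of $\Delta$ other than $F$. Then for every integer $i$ $$\beta_{i,n}(\Delta)=\beta_{i-1,\,n-|F|}(\Gamma).$$ -/

import Mathlib

open MvPolynomial

namespace FacetIdeals

section Resolutions

variable {k : Type*} [Field k] {σ : Type*}

/-- `v` is a homogeneous element of degree `j` of the graded free module `⨁ₐ S(-deg a)`,
where `S = k[σ]` carries the standard grading: every monomial occurring in the coordinate `a`
has degree `j - deg a`. -/
def IsHomogeneousVec {r : ℕ} (deg : Fin r → ℕ) (j : ℕ) (v : Fin r → MvPolynomial σ k) : Prop :=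
  ∀ a m, coeff m (v a) ≠ 0 → m.degree + deg a = j

/-- A minimal graded free resolution
`⋯ → ⨁ₐ S(-deg 1 a) → ⨁ₐ S(-deg 0 a) → S ⧸ I → 0` of `S ⧸ I`, where `S = k[σ]`, by graded free
modules of finite rank.  All maps are homogeneous of degree `0`, and minimality says that each
differential has its image in `𝔪 F`, where `𝔪` is the ideal generated by the variables. -/
structure MinimalGradedFreeResolution (I : Ideal (MvPolynomial σ k)) where
  /-- the rank of the free module in homological degree `i` -/
  rank : ℕ → ℕ
  /-- the degrees of the basis elements in homological degree `i` -/
  deg : ∀ i, Fin (rank i) → ℕ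
  /-- the differentials -/
  d : ∀ i, (Fin (rank (i + 1)) → MvPolynomial σ k) →ₗ[MvPolynomial σ k]
    (Fin (rank i) → MvPolynomial σ k)
  /-- the augmentation -/
  aug : (Fin (rank 0) → MvPolynomial σ k) →ₗ[MvPolynomial σ k] (MvPolynomial σ k ⧸ I)
  homogeneous_d : ∀ i b, IsHomogeneousVec (deg i) (deg (i + 1) b) (d i (Pi.single b 1))
  homogeneous_aug : ∀ b, ∃ p : MvPolynomial σ k, p.IsHomogeneous (deg 0 b) ∧
    aug (Pi.single b 1) = Ideal.Quotient.mk I p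
  surjective_aug : Function.Surjective aug
  exact_aug : Function.Exact (d 0) aug
  exact_d : ∀ i, Function.Exact (d (i + 1)) (d i)
  minimal : ∀ i v a, constantCoeff (d i v a) = 0

/-- The number of summands `S(-j)` in homological degree `i` of the resolution; it is `0` for
negative `i` (and for negative `j`). -/
def MinimalGradedFreeResolution.betti {I : Ideal (MvPolynomial σ k)}
    (P : MinimalGradedFreeResolution I) (i j : ℤ) : ℕ :=
  if 0 ≤ i then (Finset.univ.filter fun a => (P.deg i.toNat a : ℤ) = j).card else 0

/-! ### Existence of minimal graded free resolutions -/

/-- The homogeneous component of degree `j` of an element of a graded free module. -/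
noncomputable def comp {r : ℕ} (deg : Fin r → ℕ) (j : ℕ) (v : Fin r → MvPolynomial σ k) :
    Fin r → MvPolynomial σ k :=
  fun a => if deg a ≤ j then homogeneousComponent (j - deg a) (v a) else 0

theorem coeff_comp {r : ℕ} (deg : Fin r → ℕ) (j : ℕ) (v : Fin r → MvPolynomial σ k) (a : Fin r)
    (m : σ →₀ ℕ) :
    coeff m (comp deg j v a) = if m.degree + deg a = j then coeff m (v a) else 0 := by
  unfold comp
  split_ifs with h1 h2 h2
  · rw [coeff_homogeneousComponent, if_pos (by omega)]
  · rw [coeff_homogeneousComponent, if_neg (by omega)]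
  · omega
  · simp

theorem isHomogeneousVec_comp {r : ℕ} (deg : Fin r → ℕ) (j : ℕ) (v : Fin r → MvPolynomial σ k) :
    IsHomogeneousVec deg j (comp deg j v) := by
  intro a m h
  rw [coeff_comp] at h
  by_contra h'
  simp [h'] at h

theorem exists_sum_comp {r : ℕ} (deg : Fin r → ℕ) (v : Fin r → MvPolynomial σ k) :
    ∃ B : ℕ, ∑ j ∈ Finset.range B, comp deg j v = v := by
  refine ⟨∑ a, ((v a).totalDegree + deg a) + 1, ?_⟩
  ext a m
  rw [Finset.sum_apply, coeff_sum]
  simp only [coeff_comp]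
  rw [Finset.sum_ite_eq]
  split_ifs with h
  · rfl
  · by_contra h'
    have h1 : m.degree ≤ (v a).totalDegree := by
      rw [Finsupp.degree_apply]
      have := le_totalDegree (p := v a) (s := m) (mem_support_iff.2 (Ne.symm h'))
      simpa [Finsupp.sum] using this
    have h2 := Finset.single_le_sum (f := fun a => (v a).totalDegree + deg a)
      (fun _ _ => Nat.zero_le _) (Finset.mem_univ a)
    simp only [Finset.mem_range] at h h2
    omega

theorem eq_zero_of_sum_eq_zero {r : ℕ} {deg : Fin r → ℕ} {B : ℕ}
    {w : ℕ → Fin r → MvPolynomial σ k} (hw : ∀ j, IsHomogeneousVec deg j (w j))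
    (h : ∑ j ∈ Finset.range B, w j = 0) {j : ℕ} (hj : j < B) : w j = 0 := by
  ext a m
  by_contra hne
  rw [Pi.zero_apply, coeff_zero] at hne
  have hjm := hw j a m hne
  have h0 := congrArg (coeff m) (congrFun h a)
  rw [Finset.sum_apply, coeff_sum, Finset.sum_eq_single j] at h0
  · exact hne (by simpa using h0)
  · intro j' _ hj'
    by_contra hne'
    exact hj' ((hw j' a m hne').symm.trans hjm)
  · intro hj'
    exact absurd (Finset.mem_range.2 hj) hj'

theorem isHomogeneousVec_map {r s : ℕ} {deg : Fin r → ℕ} {deg' : Fin s → ℕ}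
    (φ : (Fin s → MvPolynomial σ k) →ₗ[MvPolynomial σ k] (Fin r → MvPolynomial σ k))
    (hφ : ∀ b, IsHomogeneousVec deg (deg' b) (φ (Pi.single b 1))) {j : ℕ}
    {v : Fin s → MvPolynomial σ k} (hv : IsHomogeneousVec deg' j v) :
    IsHomogeneousVec deg j (φ v) := by
  classical
  intro a m h
  have hsum : v = ∑ b, v b • (Pi.single b 1 : Fin s → MvPolynomial σ k) := by
    ext c; simp [Finset.sum_apply, Pi.single_apply]
  rw [hsum, map_sum, Finset.sum_apply, coeff_sum] at h
  obtain ⟨b, -, hb⟩ := Finset.exists_ne_zero_of_sum_ne_zero h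
  rw [map_smul, Pi.smul_apply, smul_eq_mul, coeff_mul] at hb
  obtain ⟨⟨x, y⟩, hxy, hne⟩ := Finset.exists_ne_zero_of_sum_ne_zero hb
  rw [Finset.HasAntidiagonal.mem_antidiagonal] at hxy
  have h1 := hv b x (left_ne_zero_of_mul hne)
  have h2 := hφ b a y (right_ne_zero_of_mul hne)
  have h3 : m.degree = x.degree + y.degree := by rw [← hxy, map_add]
  omega

/-- The submodules of a graded free module from which the construction of a resolution can be
continued: they are graded and contained in `𝔪 F`. -/
structure Stage (σ : Type*) (k : Type*) [Field k] where
  /-- the rank of the free module -/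
  r : ℕ
  /-- the degrees of its basis elements -/
  deg : Fin r → ℕ
  /-- the submodule -/
  N : Submodule (MvPolynomial σ k) (Fin r → MvPolynomial σ k)
  graded : N ≤ Submodule.span _ {v | v ∈ N ∧ ∃ j, IsHomogeneousVec deg j v}
  small : ∀ v ∈ N, ∀ a, constantCoeff (v a) = 0

theorem Stage.exists_next [Finite σ] (T : Stage σ k) :
    ∃ (T' : Stage σ k) (φ : (Fin T'.r → MvPolynomial σ k) →ₗ[MvPolynomial σ k]
      (Fin T.r → MvPolynomial σ k)),
      (∀ b, IsHomogeneousVec T.deg (T'.deg b) (φ (Pi.single b 1))) ∧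
      LinearMap.range φ = T.N ∧ LinearMap.ker φ = T'.N := by
  classical
  have hex : ∃ s : ℕ, ∃ g : Fin s → (Fin T.r → MvPolynomial σ k),
      (∀ b, ∃ j, IsHomogeneousVec T.deg j (g b)) ∧
      Submodule.span (MvPolynomial σ k) (Set.range g) = T.N := by
    have hN : T.N = Submodule.span _ {v | v ∈ T.N ∧ ∃ j, IsHomogeneousVec T.deg j v} :=
      le_antisymm T.graded (Submodule.span_le.2 fun v hv => hv.1)
    have hfg : (Submodule.span (MvPolynomial σ k)
        {v | v ∈ T.N ∧ ∃ j, IsHomogeneousVec T.deg j v}).FG := IsNoetherian.noetherian _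
    obtain ⟨t, ht, hspan⟩ := (Submodule.fg_span_iff_fg_span_finset_subset _).1 hfg
    refine ⟨t.card, fun b => (t.equivFin.symm b : Fin T.r → MvPolynomial σ k), fun b => ?_, ?_⟩
    · exact (ht (t.equivFin.symm b).2).2
    · rw [hN, hspan]
      congr 1
      ext v
      constructor
      · rintro ⟨b, rfl⟩
        exact (t.equivFin.symm b).2
      · intro hv
        exact ⟨t.equivFin ⟨v, hv⟩, by simp⟩
  obtain ⟨g, hg, hspan⟩ := Nat.find_spec hex
  have hmin := fun s' => Nat.find_min hex (m := s')
  generalize Nat.find hex = s at g hg hspan hmin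
  choose deg' hdeg' using hg
  let φ := Fintype.linearCombination (MvPolynomial σ k) g
  have hφ : ∀ b, φ (Pi.single b 1) = g b := fun b => by
    simp [φ, Fintype.linearCombination_apply_single]
  have hφh : ∀ b, IsHomogeneousVec T.deg (deg' b) (φ (Pi.single b 1)) := fun b => by
    rw [hφ]; exact hdeg' b
  have hcomp : ∀ v ∈ LinearMap.ker φ, ∀ j, comp deg' j v ∈ LinearMap.ker φ := by
    intro v hv j
    obtain ⟨B, hB⟩ := exists_sum_comp deg' v
    by_cases hj : j < B
    · refine eq_zero_of_sum_eq_zero (deg := T.deg) (w := fun j => φ (comp deg' j v))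
        (fun j => isHomogeneousVec_map φ hφh (isHomogeneousVec_comp _ _ _)) ?_ hj
      rw [← map_sum, hB]
      exact hv
    · have : comp deg' j v = 0 := by
        ext a m
        rw [coeff_comp]
        split_ifs with h
        · rw [← hB, Finset.sum_apply, coeff_sum]
          refine Finset.sum_eq_zero fun j' hj' => ?_
          rw [coeff_comp, if_neg]
          have := Finset.mem_range.1 hj'
          omega
        · simp
      rw [this]
      exact zero_mem _
  refine ⟨⟨s, deg', LinearMap.ker φ, ?_, ?_⟩, φ, hφh, ?_, rfl⟩
  · intro v hv
    obtain ⟨B, hB⟩ := exists_sum_comp deg' v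
    rw [← hB]
    exact Submodule.sum_mem _ fun j _ => Submodule.subset_span
      ⟨hcomp v hv j, j, isHomogeneousVec_comp _ _ _⟩
  · intro v hv b
    by_contra hc
    have hw := hcomp v hv (deg' b)
    set w := comp deg' (deg' b) v with hwdef
    have hwb : w b = C (constantCoeff (v b)) := by
      simp [hwdef, comp, homogeneousComponent_zero, constantCoeff_eq]
    obtain _ | s' := s
    · exact b.elim0
    refine hmin s' (Nat.lt_succ_self _) ⟨fun c => g (b.succAbove c), fun c => ⟨_, hdeg' _⟩, ?_⟩
    refine le_antisymm ?_ ?_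
    · rw [← hspan]
      refine Submodule.span_mono ?_
      rintro _ ⟨c, rfl⟩
      exact ⟨_, rfl⟩
    · rw [← hspan, Submodule.span_le]
      rintro _ ⟨c, rfl⟩
      rcases eq_or_ne c b with rfl | hcb
      · have h0 : ∑ c', w c' • g c' = 0 := by
          simpa [φ, Fintype.linearCombination_apply] using hw
        rw [Fin.sum_univ_succAbove _ c, hwb] at h0
        have h1 : g c = -(C (constantCoeff (v c))⁻¹ : MvPolynomial σ k) •
            ∑ i, w (c.succAbove i) • g (c.succAbove i) := by
          rw [← neg_eq_of_add_eq_zero_right h0, smul_neg, neg_smul, neg_neg, smul_smul, ← C_mul,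
            inv_mul_cancel₀ hc, C_1, one_smul]
        rw [h1]
        exact Submodule.smul_mem _ _ (Submodule.sum_mem _ fun i _ =>
          Submodule.smul_mem _ _ (Submodule.subset_span ⟨i, rfl⟩))
      · obtain ⟨i, rfl⟩ := Fin.exists_succAbove_eq hcb
        exact Submodule.subset_span ⟨i, rfl⟩
  · exact (Fintype.range_linearCombination _ _).trans hspan

/-- If the submodule of the first stage is the kernel of a homogeneous presentation of `S ⧸ I`,
then `S ⧸ I` has a minimal graded free resolution. -/
theorem Stage.nonempty_resolution [Finite σ] {I : Ideal (MvPolynomial σ k)} (T : Stage σ k)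
    (aug : (Fin T.r → MvPolynomial σ k) →ₗ[MvPolynomial σ k] (MvPolynomial σ k ⧸ I))
    (h1 : ∀ b, ∃ p : MvPolynomial σ k, p.IsHomogeneous (T.deg b) ∧
      aug (Pi.single b 1) = Ideal.Quotient.mk I p)
    (h2 : Function.Surjective aug) (h3 : LinearMap.ker aug = T.N) :
    Nonempty (MinimalGradedFreeResolution I) := by
  choose next φ hφ hr hk using fun T : Stage σ k => T.exists_next
  let st : ℕ → Stage σ k := fun i => Nat.rec T (fun _ T' => next T') i
  exact ⟨{
    rank := fun i => (st i).r
    deg := fun i => (st i).deg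
    d := fun i => φ (st i)
    aug := aug
    homogeneous_d := fun i b => hφ (st i) b
    homogeneous_aug := h1
    surjective_aug := h2
    exact_aug := LinearMap.exact_iff.2 (h3.trans (hr T).symm)
    exact_d := fun i => LinearMap.exact_iff.2 ((hk (st i)).trans (hr (st (i + 1))).symm)
    minimal := fun i v a => (st i).small _ (by rw [← hr (st i)]; exact ⟨v, rfl⟩) a }⟩

theorem nonempty_resolution [Finite σ] {A : Set (MvPolynomial σ k)}
    (hA : ∀ p ∈ A, ∃ j, p.IsHomogeneous j) :
    Nonempty (MinimalGradedFreeResolution (Ideal.span A)) := by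
  by_cases htop : Ideal.span A = ⊤
  · have hsub : Subsingleton (MvPolynomial σ k ⧸ Ideal.span A) :=
      Ideal.Quotient.subsingleton_iff.2 htop
    refine Stage.nonempty_resolution ⟨0, Fin.elim0, ⊥, bot_le, fun v _ a => a.elim0⟩ 0
      (fun b => b.elim0) (fun x => ⟨0, Subsingleton.elim _ _⟩) ?_
    exact Subsingleton.elim _ _
  · let π : (Fin 1 → MvPolynomial σ k) →ₗ[MvPolynomial σ k] MvPolynomial σ k :=
      LinearMap.proj 0
    let e : MvPolynomial σ k →ₗ[MvPolynomial σ k] (Fin 1 → MvPolynomial σ k) :=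
      LinearMap.pi fun _ => LinearMap.id
    have he : ∀ v : Fin 1 → MvPolynomial σ k, e (v 0) = v := fun v => by
      ext a; simp [e, Subsingleton.elim a 0]
    refine Stage.nonempty_resolution
      ⟨1, fun _ => 0, Submodule.comap π (Ideal.span A), fun v hv => ?_, fun v hv a => ?_⟩
      ((Ideal.span A).mkQ ∘ₗ π) (fun b => ⟨1, isHomogeneous_one _ _, ?_⟩) ?_ ?_
    · have h1 : v 0 ∈ Ideal.span A := hv
      have h2 : e (v 0) ∈ Submodule.map e (Ideal.span A) := Submodule.mem_map_of_mem h1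
      rw [he, Ideal.span, Submodule.map_span] at h2
      refine Submodule.span_mono ?_ h2
      rintro _ ⟨p, hp, rfl⟩
      obtain ⟨j, hj⟩ := hA p hp
      refine ⟨Ideal.subset_span hp, j, fun a m hm => ?_⟩
      have hm' : coeff m p ≠ 0 := by simpa [e] using hm
      have := hj.coeff_eq_zero (d := m)
      by_contra hne
      exact hm' (this (by simpa using hne))
    · have h1 : v a ∈ Ideal.span A := by rw [Subsingleton.elim a 0]; exact hv
      have h2 : Ideal.span A ≤ RingHom.ker (constantCoeff (R := k) (σ := σ)) := by
        rw [Ideal.span_le]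
        intro p hp
        by_contra hne
        have hne : constantCoeff p ≠ 0 := hne
        obtain ⟨j, hj⟩ := hA p hp
        have hj0 : j = 0 := by
          by_contra hj0
          exact hne (hj.coeff_eq_zero (d := 0) (by simpa using Ne.symm hj0))
        subst hj0
        have hpC : p = C (constantCoeff p) :=
          totalDegree_eq_zero_iff_eq_C.1 (Nat.le_zero.1 hj.totalDegree_le)
        refine htop (Ideal.eq_top_of_isUnit_mem _ (Ideal.subset_span hp) ?_)
        rw [hpC]
        exact (isUnit_iff_ne_zero.2 hne).map C
      exact h2 h1
    · rw [Subsingleton.elim b 0]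
      simp [π]
    · intro x
      obtain ⟨p, rfl⟩ := Ideal.Quotient.mk_surjective x
      exact ⟨e p, by simp [π, e]⟩
    · exact (LinearMap.ker_comp _ _).trans (by rw [Submodule.ker_mkQ])

end Resolutions

section Complexes

/-- A simplicial complex with vertices in `σ`: a set of finite subsets of `σ` that contains with
each `F` all subsets of `F`.  The void complex, without any face, is allowed. -/
abbrev SimplicialComplex (σ : Type*) := LowerSet (Finset σ)

namespace SimplicialComplex

variable {σ : Type*}

/-- The facets of `Δ`: the faces that are maximal under inclusion. -/
def facets (Δ : SimplicialComplex σ) : Set (Finset σ) := {F | Maximal (· ∈ Δ) F}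

open Classical in
/-- The set `V(Δ)` of vertices of `Δ`. -/
noncomputable def vertices [Fintype σ] (Δ : SimplicialComplex σ) : Finset σ :=
  Finset.univ.filter fun v => {v} ∈ Δ

/-- `v` is a free vertex of the facet `F`: it belongs to `F` and to no other facet. -/
def IsFreeVertex (Δ : SimplicialComplex σ) (F : Finset σ) (v : σ) : Prop :=
  v ∈ F ∧ ∀ G ∈ Δ.facets, G ≠ F → v ∉ G

/-- `Δ ∖ ⟨F⟩`: the complex generated by the facets of `Δ` other than `F`. -/
def removeFacet (Δ : SimplicialComplex σ) (F : Finset σ) : SimplicialComplex σ :=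
  lowerClosure (Δ.facets \ {F})

/-- The localization `Δ_U` of `Δ` at the prime ideal generated by the variables in `U`: its facets
are the minimal elements under inclusion among the sets `G ∩ U`, where `G` is a facet of `Δ`. -/
def localize [DecidableEq σ] (Δ : SimplicialComplex σ) (U : Finset σ) : SimplicialComplex σ :=
  lowerClosure {B | Minimal (· ∈ {A | ∃ G ∈ Δ.facets, A = G ∩ U}) B}

/-- The facet ideal of `Δ` in `S = k[σ]`, generated by the square-free monomials whose supports
are the facets of `Δ`. -/
noncomputable def facetIdeal (k : Type*) [Field k] (Δ : SimplicialComplex σ) :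
    Ideal (MvPolynomial σ k) :=
  Ideal.span {p | ∃ F ∈ Δ.facets, p = ∏ x ∈ F, X x}

theorem nonempty_resolution_facetIdeal [Finite σ] (k : Type*) [Field k]
    (Δ : SimplicialComplex σ) : Nonempty (MinimalGradedFreeResolution (Δ.facetIdeal k)) := by
  refine nonempty_resolution ?_
  rintro _ ⟨F, -, rfl⟩
  exact ⟨_, IsHomogeneous.prod F _ (fun _ => 1) fun x _ => isHomogeneous_X k x⟩

/-- The graded Betti number `β_{i,j}(Δ)` over `k`: the number of summands `S(-j)` in homological
degree `i` of a minimal graded free resolution of `S ⧸ I`, where `I` is the facet ideal of `Δ`. -/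
noncomputable def betti [Finite σ] (k : Type*) [Field k] (Δ : SimplicialComplex σ) (i j : ℤ) : ℕ :=
  (Classical.choice (Δ.nonempty_resolution_facetIdeal k)).betti i j

theorem facets_localize [Finite σ] [DecidableEq σ] (Δ : SimplicialComplex σ) (U : Finset σ) :
    (Δ.localize U).facets = {B | Minimal (· ∈ {A | ∃ G ∈ Δ.facets, A = G ∩ U}) B} := by
  ext B
  constructor
  · intro hB
    obtain ⟨A, hA, hBA⟩ := mem_lowerClosure.1 hB.1
    have hAB : A ≤ B := hB.2 (mem_lowerClosure.2 ⟨A, hA, le_rfl⟩) hBA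
    rwa [le_antisymm hBA hAB]
  · intro hB
    refine ⟨mem_lowerClosure.2 ⟨B, hB, le_rfl⟩, fun B' hB' hle => ?_⟩
    obtain ⟨A, hA, hBA⟩ := mem_lowerClosure.1 hB'
    exact hBA.trans (hA.2 hB.1 (hle.trans hBA))

/-- In the localization `S_P` of `S` at the prime ideal `P` generated by the variables in `U`, the
facet ideals of `Δ` and of `Δ_U` generate the same ideal. -/
theorem map_facetIdeal_localize [Finite σ] [DecidableEq σ] (k : Type*) [Field k]
    (Δ : SimplicialComplex σ) (U : Finset σ) (P : Ideal (MvPolynomial σ k)) [P.IsPrime]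
    (hP : P = Ideal.span (X '' (U : Set σ))) :
    ((Δ.localize U).facetIdeal k).map (algebraMap _ (Localization.AtPrime P)) =
      (Δ.facetIdeal k).map (algebraMap _ (Localization.AtPrime P)) := by
  have hunit : ∀ G : Finset σ, IsUnit (algebraMap (MvPolynomial σ k) (Localization.AtPrime P)
      (∏ x ∈ G \ U, X x)) := by
    intro G
    refine IsLocalization.map_units _ (⟨_, ?_⟩ : P.primeCompl)
    refine Submonoid.prod_mem _ fun x hx => ?_
    change X x ∉ P
    rw [hP, mem_ideal_span_X_image]
    push Not
    refine ⟨Finsupp.single x 1, by simp [X], fun y hy => ?_⟩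
    have : y ≠ x := by
      rintro rfl
      exact (Finset.mem_sdiff.1 hx).2 hy
    simp [this.symm]
  have hfac : ∀ G : Finset σ, (∏ x ∈ G, X x : MvPolynomial σ k) =
      (∏ x ∈ G \ U, X x) * ∏ x ∈ G ∩ U, X x := by
    intro G
    rw [mul_comm, Finset.prod_inter_mul_prod_sdiff]
  rw [facetIdeal, facetIdeal, facets_localize, Ideal.map_span, Ideal.map_span]
  apply le_antisymm <;> rw [Ideal.span_le]
  · rintro _ ⟨_, ⟨B, hB, rfl⟩, rfl⟩
    obtain ⟨G, hG, rfl⟩ := hB.1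
    have h1 : algebraMap (MvPolynomial σ k) (Localization.AtPrime P) (∏ x ∈ G, X x) ∈
        Ideal.span (algebraMap (MvPolynomial σ k) (Localization.AtPrime P) ''
          {p | ∃ F ∈ Δ.facets, p = ∏ x ∈ F, X x}) :=
      Ideal.subset_span ⟨_, ⟨G, hG, rfl⟩, rfl⟩
    rw [hfac, map_mul] at h1
    exact (Ideal.unit_mul_mem_iff_mem _ (hunit G)).1 h1
  · rintro _ ⟨_, ⟨G, hG, rfl⟩, rfl⟩
    obtain ⟨B, hBG, hB⟩ := (Set.toFinite {A | ∃ G ∈ Δ.facets, A = G ∩ U}).exists_le_minimal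
      (⟨G, hG, rfl⟩ : G ∩ U ∈ {A | ∃ G ∈ Δ.facets, A = G ∩ U})
    rw [← Finset.prod_sdiff (hBG.trans Finset.inter_subset_left : B ⊆ G), map_mul]
    exact Ideal.mul_mem_left _ _ (Ideal.subset_span ⟨_, ⟨B, hB, rfl⟩, rfl⟩)

end SimplicialComplex

end Complexes

end FacetIdeals

/-! Let J be the facet ideal of Δ ∖ ⟨F⟩ and p the product of the variables in F. The facet ideal of
Δ is J + (p), and the colon ideal J : p is generated by the monomials with supports G ∖ F, so it is
the facet ideal of Γ (`mem_squarefreeIdeal_sdiff`, `facetIdeal_localize`). Hence 0 → S/(J : p)(-|F|)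
→ S/J → S/(J + (p)) → 0 is exact, and resolutions P of S/(J : p) and Q of S/J give a mapping cone
that resolves S/(J + (p)) (`exists_cone`).

The free vertex v makes J an ideal in the n - 1 variables of V(Δ) ∖ {v}. A square-free monomial
ideal in the variables U has a resolution in degrees at most |U| (`exists_resolution_deg_le`, by
iterating the same cone), so Q can be chosen without basis elements of degree n. In degree n the
cone is then P, shifted by 1 homologically and by |F| in degree.

For P minimal, the cone has no unit entries in degree n, though it may have some in other degrees.
This is enough: the number of basis elements of degree j is the same in any two resolutions that are
minimal in that one degree (`card_le_card`). -/

namespace FacetIdeals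

/-! ### Homogeneous matrices and homogeneous lifting -/

section GradedMatrices

variable {k : Type*} [Field k] {σ : Type*} {α β γ : Type*}

/-- The part of degree `j` of an element of the graded free module `⨁ₐ S(-deg a)`. -/
noncomputable def homogeneousPart (deg : α → ℕ) (j : ℕ) (v : α → MvPolynomial σ k) :
    α → MvPolynomial σ k :=
  fun a => if deg a ≤ j then homogeneousComponent (j - deg a) (v a) else 0

theorem coeff_homogeneousPart (deg : α → ℕ) (j : ℕ) (v : α → MvPolynomial σ k) (a : α)
    (m : σ →₀ ℕ) :
    coeff m (homogeneousPart deg j v a) = if m.degree + deg a = j then coeff m (v a) else 0 := by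
  unfold homogeneousPart
  split_ifs with h1 h2 h2
  · rw [coeff_homogeneousComponent, if_pos (by omega)]
  · rw [coeff_homogeneousComponent, if_neg (by omega)]
  · omega
  · simp

/-- The matrix `A` describes a homogeneous map of degree `e` from `⨁_b S(-degc b)` to
`⨁ₐ S(-degr a)`. -/
def IsHomogeneousMatrix (degr : α → ℕ) (degc : β → ℕ) (e : ℕ)
    (A : Matrix α β (MvPolynomial σ k)) : Prop :=
  ∀ a b m, coeff m (A a b) ≠ 0 → m.degree + degr a = degc b + e

theorem IsHomogeneousMatrix.mul [Fintype β] {da : α → ℕ} {db : β → ℕ} {dc : γ → ℕ} {e e' : ℕ}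
    {A : Matrix α β (MvPolynomial σ k)} {B : Matrix β γ (MvPolynomial σ k)}
    (hA : IsHomogeneousMatrix da db e A) (hB : IsHomogeneousMatrix db dc e' B) :
    IsHomogeneousMatrix da dc (e + e') (A * B) := by
  classical
  intro a c m h
  rw [Matrix.mul_apply, coeff_sum] at h
  obtain ⟨b, -, hb⟩ := Finset.exists_ne_zero_of_sum_ne_zero h
  rw [coeff_mul] at hb
  obtain ⟨⟨x, y⟩, hxy, hne⟩ := Finset.exists_ne_zero_of_sum_ne_zero hb
  rw [Finset.HasAntidiagonal.mem_antidiagonal] at hxy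
  have h1 := hA a b x (left_ne_zero_of_mul hne)
  have h2 := hB b c y (right_ne_zero_of_mul hne)
  have h3 : m.degree = x.degree + y.degree := by rw [← hxy, map_add]
  omega

/-- The vector `u` is a degree-0 map to S(-s), and such maps commute with taking homogeneous parts.
Treating one row with a free shift `s` covers both the rows of a differential and the augmentation,
where `s = 0`; hence the `+ 0` in `homogeneous_aug`. -/
theorem coeff_dotProduct_homogeneousPart [Fintype β] {deg : β → ℕ} {s : ℕ}
    {u : β → MvPolynomial σ k} (hu : ∀ b m, coeff m (u b) ≠ 0 → m.degree + s = deg b)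
    (j : ℕ) (w : β → MvPolynomial σ k) (m : σ →₀ ℕ) :
    coeff m (u ⬝ᵥ homogeneousPart deg j w) = if m.degree + s = j then coeff m (u ⬝ᵥ w) else 0 := by
  classical
  simp only [dotProduct, coeff_sum, coeff_mul]
  have : ∀ b, ∀ x ∈ Finset.HasAntidiagonal.antidiagonal m,
      coeff x.1 (u b) * coeff x.2 (homogeneousPart deg j w b) =
      if m.degree + s = j then coeff x.1 (u b) * coeff x.2 (w b) else 0 := by
    intro b x hx
    rw [Finset.HasAntidiagonal.mem_antidiagonal] at hx
    by_cases h0 : coeff x.1 (u b) = 0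
    · simp [h0]
    · have h1 := hu b _ h0
      have h3 : m.degree = x.1.degree + x.2.degree := by rw [← hx, map_add]
      rw [coeff_homogeneousPart]
      by_cases h : m.degree + s = j
      · rw [if_pos h, if_pos (by omega)]
      · rw [if_neg h, if_neg (by omega), mul_zero]
  rw [Finset.sum_congr rfl fun b _ => Finset.sum_congr rfl (this b)]
  split_ifs <;> simp

theorem IsHomogeneousMatrix.mulVec_homogeneousPart [Fintype β] {da : α → ℕ} {db : β → ℕ}
    {A : Matrix α β (MvPolynomial σ k)} (hA : IsHomogeneousMatrix da db 0 A) (j : ℕ)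
    (w : β → MvPolynomial σ k) :
    A.mulVec (homogeneousPart db j w) = homogeneousPart da j (A.mulVec w) := by
  ext a m
  rw [coeff_homogeneousPart]
  exact coeff_dotProduct_homogeneousPart (fun b m h => hA a b m h) j w m

/-- If the columns of `X` lie in the image of a homogeneous map `A`, and `X` is homogeneous, then
`X` factors through `A` by a homogeneous map. -/
theorem IsHomogeneousMatrix.exists_mul_eq [Fintype β] {da : α → ℕ} {db : β → ℕ} {dc : γ → ℕ}
    {e : ℕ} {A : Matrix α β (MvPolynomial σ k)} {X : Matrix α γ (MvPolynomial σ k)}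
    (hA : IsHomogeneousMatrix da db 0 A) (hX : IsHomogeneousMatrix da dc e X)
    (h : ∀ c, ∃ w, A.mulVec w = X.col c) :
    ∃ W : Matrix β γ (MvPolynomial σ k), IsHomogeneousMatrix db dc e W ∧ A * W = X := by
  choose w hw using h
  -- Arbitrary preimages of the columns are cut down to the degree prescribed for them; column c of
  -- `X` is already homogeneous of that degree, so the product does not change.
  refine ⟨Matrix.of fun b c => homogeneousPart db (dc c + e) (w c) b, ?_, ?_⟩
  · intro b c m hm
    rw [Matrix.of_apply, coeff_homogeneousPart] at hm
    by_contra h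
    simp [h] at hm
  · ext a c m
    have h1 := congrFun (hA.mulVec_homogeneousPart (dc c + e) (w c)) a
    rw [hw] at h1
    have h2 : (A * Matrix.of fun b c => homogeneousPart db (dc c + e) (w c) b) a c =
        homogeneousPart da (dc c + e) (X.col c) a := h1
    rw [h2, coeff_homogeneousPart]
    split_ifs with h3
    · rfl
    · by_contra h4
      exact h3 (hX a c m (Ne.symm h4))

end GradedMatrices

/-- A graded free resolution of `S ⧸ I` by modules of finite rank, not necessarily minimal.
The differentials are given by matrices, and the augmentation sends the basis element `a` to the
class of the polynomial `aug a`. -/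
structure GradedFreeResolution {k : Type*} [Field k] {σ : Type*}
    (I : Ideal (MvPolynomial σ k)) where
  /-- the index sets of the bases -/
  ι : ℕ → Type
  /-- the bases are finite -/
  fintype : ∀ i, Fintype (ι i)
  /-- the degrees of the basis elements -/
  deg : ∀ i, ι i → ℕ
  /-- the differentials -/
  d : ∀ i, Matrix (ι i) (ι (i + 1)) (MvPolynomial σ k)
  /-- the augmentation -/
  aug : ι 0 → MvPolynomial σ k
  homogeneous_d : ∀ i, IsHomogeneousMatrix (deg i) (deg (i + 1)) 0 (d i)
  homogeneous_aug : ∀ a m, coeff m (aug a) ≠ 0 → m.degree + 0 = deg 0 a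
  surjective_aug : ∀ p, ∃ v, aug ⬝ᵥ v - p ∈ I
  exact_aug : ∀ v, aug ⬝ᵥ v ∈ I ↔ ∃ w, (d 0).mulVec w = v
  exact_d : ∀ i v, (d i).mulVec v = 0 ↔ ∃ w, (d (i + 1)).mulVec w = v

/-! ### Comparison maps, homotopies and uniqueness of Betti numbers -/

namespace GradedFreeResolution

attribute [instance] GradedFreeResolution.fintype

variable {k : Type*} [Field k] {σ : Type*} {I J : Ideal (MvPolynomial σ k)}

/-- `v` is a cycle in homological degree `i` of the augmented resolution. -/
def IsCycle (P : GradedFreeResolution I) : ∀ i, (P.ι i → MvPolynomial σ k) → Prop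
  | 0, v => P.aug ⬝ᵥ v ∈ I
  | i + 1, v => (P.d i).mulVec v = 0

theorem isCycle_iff (P : GradedFreeResolution I) (i : ℕ) (v : P.ι i → MvPolynomial σ k) :
    P.IsCycle i v ↔ ∃ w, (P.d i).mulVec w = v := by
  cases i with
  | zero => exact P.exact_aug v
  | succ i => exact P.exact_d i v

theorem isCycle_col (P : GradedFreeResolution I) (i : ℕ) (b : P.ι (i + 1)) :
    P.IsCycle i ((P.d i).col b) := by
  classical
  exact (P.isCycle_iff i _).2 ⟨Pi.single b 1, by simp⟩

theorem d_mul_d (P : GradedFreeResolution I) (i : ℕ) : P.d i * P.d (i + 1) = 0 := by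
  ext1 a b
  exact congrFun (P.isCycle_col (i + 1) b) a

/-- A matrix whose columns are cycles factors through the next differential. -/
theorem exists_d_mul_eq (P : GradedFreeResolution I) (i : ℕ) {γ : Type*}
    {X : Matrix (P.ι i) γ (MvPolynomial σ k)} (hX : ∀ c, P.IsCycle i (X.col c)) :
    ∃ W : Matrix (P.ι (i + 1)) γ (MvPolynomial σ k), P.d i * W = X := by
  choose w hw using fun c => (P.isCycle_iff i _).1 (hX c)
  exact ⟨Matrix.of fun b c => w c b, by ext1 a c; exact congrFun (hw c) a⟩

/-- Inductive step of the comparison theorem. Carrying "cycles go to cycles" along, instead of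
commutation with the previous differential, lets the same step start at the augmentation. -/
theorem exists_lift_succ (P : GradedFreeResolution I) (Q : GradedFreeResolution J) {e i : ℕ}
    {f : Matrix (Q.ι i) (P.ι i) (MvPolynomial σ k)}
    (hf : IsHomogeneousMatrix (Q.deg i) (P.deg i) e f)
    (hcyc : ∀ v, P.IsCycle i v → Q.IsCycle i (f.mulVec v)) :
    ∃ f' : Matrix (Q.ι (i + 1)) (P.ι (i + 1)) (MvPolynomial σ k),
      (IsHomogeneousMatrix (Q.deg (i + 1)) (P.deg (i + 1)) e f' ∧
        ∀ v, P.IsCycle (i + 1) v → Q.IsCycle (i + 1) (f'.mulVec v)) ∧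
      Q.d i * f' = f * P.d i := by
  obtain ⟨f', hf', h⟩ := (Q.homogeneous_d i).exists_mul_eq (hf.mul (P.homogeneous_d i))
    fun b => (Q.isCycle_iff i _).1 (hcyc _ (P.isCycle_col i b))
  refine ⟨f', ⟨hf', fun v hv => ?_⟩, h⟩
  have hv' : (P.d i).mulVec v = 0 := hv
  change (Q.d i).mulVec (f'.mulVec v) = 0
  rw [Matrix.mulVec_mulVec, h, ← Matrix.mulVec_mulVec, hv', Matrix.mulVec_zero]

/-- Multiplication by `p : S ⧸ I → S ⧸ J` lifts to a homogeneous map of resolutions. -/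
theorem exists_lift (P : GradedFreeResolution I) (Q : GradedFreeResolution J)
    {p : MvPolynomial σ k} {e : ℕ} (hp : p.IsHomogeneous e) (hIJ : ∀ q ∈ I, p * q ∈ J)
    (hJ : ∀ q ∈ J, ∀ j, homogeneousComponent j q ∈ J) :
    ∃ f : ∀ i, Matrix (Q.ι i) (P.ι i) (MvPolynomial σ k),
      (∀ i, IsHomogeneousMatrix (Q.deg i) (P.deg i) e (f i)) ∧
      (∀ i, Q.d i * f (i + 1) = f i * P.d i) ∧
      ∀ v, Q.aug ⬝ᵥ (f 0).mulVec v - p * P.aug ⬝ᵥ v ∈ J := by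
  have h0 : ∃ f : Matrix (Q.ι 0) (P.ι 0) (MvPolynomial σ k),
      IsHomogeneousMatrix (Q.deg 0) (P.deg 0) e f ∧
      ∀ b, Q.aug ⬝ᵥ f.col b - p * P.aug b ∈ J := by
    -- Preimages under the augmentation exist only modulo J. Their parts of degree `P.deg 0 b + e`
    -- still work, because J is graded and contains the corresponding component of the error.
    choose w hw using fun b => Q.surjective_aug (p * P.aug b)
    refine ⟨Matrix.of fun a b => homogeneousPart (Q.deg 0) (P.deg 0 b + e) (w b) a, ?_, ?_⟩
    · intro a b m hm
      rw [Matrix.of_apply, coeff_homogeneousPart] at hm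
      by_contra h
      simp [h] at hm
    · intro b
      convert hJ _ (hw b) (P.deg 0 b + e) using 1
      rw [map_sub]
      congr 1
      · ext m
        rw [coeff_homogeneousComponent]
        exact coeff_dotProduct_homogeneousPart Q.homogeneous_aug _ (w b) m
      · have h : (P.aug b).IsHomogeneous (P.deg 0 b) := by
          intro m hm
          have h := P.homogeneous_aug b m hm
          rwa [add_zero, Finsupp.degree_eq_weight_one] at h
        rw [add_comm, homogeneousComponent_of_mem ((mem_homogeneousSubmodule _ _).2 (hp.mul h)),
          if_pos rfl]
  obtain ⟨f₀, hf₀, hf₀'⟩ := h0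
  have haug : ∀ v, Q.aug ⬝ᵥ f₀.mulVec v - p * P.aug ⬝ᵥ v ∈ J := by
    intro v
    have : Q.aug ⬝ᵥ f₀.mulVec v - p * P.aug ⬝ᵥ v =
        ∑ b, v b * (Q.aug ⬝ᵥ f₀.col b - p * P.aug b) := by
      rw [Matrix.dotProduct_mulVec]
      simp only [dotProduct, Finset.mul_sum, ← Finset.sum_sub_distrib]
      refine Finset.sum_congr rfl fun b _ => ?_
      simp only [Matrix.vecMul, dotProduct, Matrix.col]
      simp
      ring
    rw [this]
    exact J.sum_mem fun b _ => J.mul_mem_left _ (hf₀' b)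
  have hcyc : ∀ v, P.IsCycle 0 v → Q.IsCycle 0 (f₀.mulVec v) := fun v hv =>
    (J.sub_mem_iff_left (hIJ _ hv)).1 (haug v)
  choose next hnext hcomm using fun (i : ℕ)
    (f : {f : Matrix (Q.ι i) (P.ι i) (MvPolynomial σ k) //
      IsHomogeneousMatrix (Q.deg i) (P.deg i) e f ∧
        ∀ v, P.IsCycle i v → Q.IsCycle i (f.mulVec v)}) =>
    exists_lift_succ P Q f.2.1 f.2.2
  let F : ∀ i, {f : Matrix (Q.ι i) (P.ι i) (MvPolynomial σ k) //
      IsHomogeneousMatrix (Q.deg i) (P.deg i) e f ∧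
        ∀ v, P.IsCycle i v → Q.IsCycle i (f.mulVec v)} := fun i =>
    Nat.rec ⟨f₀, hf₀, hcyc⟩ (fun i f => ⟨next i f, hnext i f⟩) i
  exact ⟨fun i => (F i).1, fun i => (F i).2.1, fun i => hcomm i (F i), haug⟩

/-- A chain endomorphism that lifts zero is null-homotopic. -/
theorem exists_homotopy (P : GradedFreeResolution I)
    (φ : ∀ i, Matrix (P.ι i) (P.ι i) (MvPolynomial σ k))
    (hφ : ∀ i : ℕ, P.d i * φ (i + 1) = φ i * P.d i) (h0 : ∀ v, P.aug ⬝ᵥ (φ 0).mulVec v ∈ I) :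
    (∃ h : Matrix (P.ι (0 + 1)) (P.ι 0) (MvPolynomial σ k), φ 0 = P.d 0 * h) ∧
    ∀ i : ℕ, ∃ (h : Matrix (P.ι (i + 1)) (P.ι i) (MvPolynomial σ k))
      (h' : Matrix (P.ι (i + 1 + 1)) (P.ι (i + 1)) (MvPolynomial σ k)),
      φ (i + 1) = P.d (i + 1) * h' + h * P.d i := by
  classical
  have hzero : ∃ h : Matrix (P.ι (0 + 1)) (P.ι 0) (MvPolynomial σ k), φ 0 = P.d 0 * h := by
    obtain ⟨h, hh⟩ := P.exists_d_mul_eq 0 (X := φ 0) fun b => by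
      have := h0 (Pi.single b 1)
      rwa [Matrix.mulVec_single_one] at this
    exact ⟨h, hh.symm⟩
  have step : ∀ i (h : Matrix (P.ι (i + 1)) (P.ι i) (MvPolynomial σ k)),
      (φ i - P.d i * h) * P.d i = 0 →
      ∃ h' : Matrix (P.ι (i + 1 + 1)) (P.ι (i + 1)) (MvPolynomial σ k),
        φ (i + 1) = P.d (i + 1) * h' + h * P.d i := by
    intro i h hh
    obtain ⟨h', hh'⟩ := P.exists_d_mul_eq (i + 1) (X := φ (i + 1) - h * P.d i) fun b => by
      have : P.d i * (φ (i + 1) - h * P.d i) = 0 := by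
        rw [Matrix.mul_sub, hφ, ← Matrix.mul_assoc, ← Matrix.sub_mul, hh]
      ext1 a
      exact congrFun (congrFun this a) b
    exact ⟨h', by rw [hh', sub_add_cancel]⟩
  -- Invariant of the induction: after subtracting d h, the map φ vanishes on boundaries, which is
  -- exactly what `step` needs. The homotopies found for different i need not agree.
  have key : ∀ i, ∃ h : Matrix (P.ι (i + 1)) (P.ι i) (MvPolynomial σ k),
      (φ i - P.d i * h) * P.d i = 0 := by
    intro i
    induction i with
    | zero =>
      obtain ⟨h, hh⟩ := hzero
      exact ⟨h, by rw [hh, sub_self, Matrix.zero_mul]⟩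
    | succ i ih =>
      obtain ⟨h, hh⟩ := ih
      obtain ⟨h', hh'⟩ := step i h hh
      exact ⟨h', by rw [hh', add_sub_cancel_left, Matrix.mul_assoc, P.d_mul_d, Matrix.mul_zero]⟩
  refine ⟨hzero, fun i => ?_⟩
  obtain ⟨h, hh⟩ := key i
  exact ⟨h, step i h hh⟩

/-- No unit occurs in the part of degree `j` of the differentials. -/
def IsMinimalInDegree (P : GradedFreeResolution I) (j : ℕ) : Prop :=
  ∀ i a b, P.deg i a = j → P.deg (i + 1) b = j → constantCoeff (P.d i a b) = 0

/-- A nonzero constant entry of a degree-0 map joins basis elements of equal degree, so it suffices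
to know one of the two degrees. -/
theorem constantCoeff_d_eq_zero (P : GradedFreeResolution I) {j : ℕ} (hP : P.IsMinimalInDegree j)
    {i : ℕ} {a : P.ι i} {b : P.ι (i + 1)} (h : P.deg i a = j ∨ P.deg (i + 1) b = j) :
    constantCoeff (P.d i a b) = 0 := by
  by_contra hne
  have := P.homogeneous_d i a b 0 hne
  simp only [map_zero, zero_add, add_zero] at this
  exact hne (hP i a b (by omega) (by omega))

/-- Lifts f : P → Q and g : Q → P of the identity have g f homotopic to 1. In degree j every term of
the homotopy contains an entry of a differential of P with zero constant term, so modulo the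
variables g f is the identity there. Thus f injects the degree-j basis space of P into that of Q,
which need not be minimal. -/
theorem card_le_card (P Q : GradedFreeResolution I) {j : ℕ} (hP : P.IsMinimalInDegree j)
    (hI : ∀ q ∈ I, ∀ j, homogeneousComponent j q ∈ I) (i : ℕ) :
    (Finset.univ.filter fun a => P.deg i a = j).card ≤
      (Finset.univ.filter fun a => Q.deg i a = j).card := by
  classical
  have h1 : (1 : MvPolynomial σ k).IsHomogeneous 0 := isHomogeneous_one _ _
  obtain ⟨f, hf, hfd, hf0⟩ := exists_lift P Q h1 (fun q hq => by rwa [one_mul]) hI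
  obtain ⟨g, hg, hgd, hg0⟩ := exists_lift Q P h1 (fun q hq => by rwa [one_mul]) hI
  obtain ⟨hz, hs⟩ := P.exists_homotopy
    (fun i : ℕ => (g i * f i - 1 : Matrix (P.ι i) (P.ι i) (MvPolynomial σ k)))
    (fun i => by
      rw [Matrix.mul_sub, ← Matrix.mul_assoc, hgd, Matrix.mul_assoc, hfd, ← Matrix.mul_assoc,
        Matrix.sub_mul, Matrix.mul_one, Matrix.one_mul])
    (fun v => by
      rw [Matrix.sub_mulVec, Matrix.one_mulVec, dotProduct_sub, ← Matrix.mulVec_mulVec]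
      have := I.add_mem (hg0 ((f 0).mulVec v)) (hf0 v)
      simpa using this)
  have hid : ∀ a b, P.deg i a = j → P.deg i b = j →
      constantCoeff ((g i * f i) a b) = (1 : Matrix (P.ι i) (P.ι i) k) a b := by
    have hφ : ∀ a b, P.deg i a = j → P.deg i b = j →
        constantCoeff ((g i * f i - 1 : Matrix (P.ι i) (P.ι i) (MvPolynomial σ k)) a b) = 0 := by
      intro a b ha hb
      cases i with
      | zero =>
        obtain ⟨h, hh⟩ := hz
        rw [hh, Matrix.mul_apply, map_sum]
        refine Finset.sum_eq_zero fun c _ => ?_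
        rw [map_mul, P.constantCoeff_d_eq_zero hP (Or.inl ha), zero_mul]
      | succ i =>
        obtain ⟨h, h', hh⟩ := hs i
        rw [hh, Matrix.add_apply, Matrix.mul_apply, Matrix.mul_apply, map_add, map_sum, map_sum,
          Finset.sum_eq_zero, Finset.sum_eq_zero, add_zero]
        · intro c _
          rw [map_mul, P.constantCoeff_d_eq_zero hP (Or.inr hb), mul_zero]
        · intro c _
          rw [map_mul, P.constantCoeff_d_eq_zero hP (Or.inl ha), zero_mul]
    intro a b ha hb
    have h := hφ a b ha hb
    rw [Matrix.sub_apply, map_sub, sub_eq_zero] at h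
    rw [h, Matrix.one_apply, Matrix.one_apply]
    split_ifs <;> simp
  let A : Matrix {c // Q.deg i c = j} {a // P.deg i a = j} k :=
    Matrix.of fun c a => constantCoeff (f i c.1 a.1)
  let B : Matrix {a // P.deg i a = j} {c // Q.deg i c = j} k :=
    Matrix.of fun a c => constantCoeff (g i a.1 c.1)
  have hBA : B * A = 1 := by
    ext a b
    have h := hid a.1 b.1 a.2 b.2
    rw [Matrix.mul_apply, map_sum] at h
    rw [Matrix.mul_apply]
    have h2 : (1 : Matrix {a // P.deg i a = j} {a // P.deg i a = j} k) a b =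
        (1 : Matrix (P.ι i) (P.ι i) k) a.1 b.1 := by
      simp [Matrix.one_apply, Subtype.ext_iff]
    rw [h2, ← h]
    simp only [A, B, Matrix.of_apply, map_mul]
    rw [← Finset.sum_subtype (Finset.univ.filter fun c => Q.deg i c = j) (by simp)
      (fun c => constantCoeff (g i a.1 c) * constantCoeff (f i c b.1))]
    -- Basis elements of Q outside degree j drop out: f has degree 0, so its constant terms preserve
    -- degree.
    refine Finset.sum_filter_of_ne fun c _ hc => ?_
    have := hf i c b.1 0 (right_ne_zero_of_mul hc)
    simpa [b.2] using this
  have hinj : Function.Injective A.mulVecLin := by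
    intro v w hvw
    have := congrArg B.mulVec hvw
    simpa [hBA] using this
  have := LinearMap.finrank_le_finrank_of_injective hinj
  simpa [Fintype.card_subtype] using this

end GradedFreeResolution
end FacetIdeals

namespace FacetIdeals
namespace GradedFreeResolution

/-! ### The mapping cone of multiplication by p -/

section Cone

variable {k : Type*} [Field k] {σ : Type*} {I J K : Ideal (MvPolynomial σ k)}
  (P : GradedFreeResolution I) (Q : GradedFreeResolution J)

/-- The index sets of the mapping cone of a map of complexes `P → Q`. -/
def coneIndex : ℕ → Type
  | 0 => Q.ι 0
  | i + 1 => Q.ι (i + 1) ⊕ P.ι i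

/-- The index sets of the mapping cone are finite. -/
instance fintypeConeIndex : ∀ i, Fintype (coneIndex P Q i)
  | 0 => Q.fintype 0
  | i + 1 => inferInstanceAs (Fintype (Q.ι (i + 1) ⊕ P.ι i))

/-- The degrees in the mapping cone of a map of degree `e`. -/
def coneDeg (e : ℕ) : ∀ i, coneIndex P Q i → ℕ
  | 0 => Q.deg 0
  | i + 1 => Sum.elim (Q.deg (i + 1)) fun a => P.deg i a + e

/-- The differentials of the mapping cone. -/
noncomputable def coneD (f : ∀ i, Matrix (Q.ι i) (P.ι i) (MvPolynomial σ k)) :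
    ∀ i, Matrix (coneIndex P Q i) (coneIndex P Q (i + 1)) (MvPolynomial σ k)
  | 0 => Matrix.fromCols (Q.d 0) (f 0)
  | i + 1 => Matrix.fromBlocks (Q.d (i + 1)) (f (i + 1)) 0 (-P.d i)

variable {P Q}

theorem coneD_zero_mulVec (f : ∀ i, Matrix (Q.ι i) (P.ι i) (MvPolynomial σ k))
    (v : Q.ι 1 → MvPolynomial σ k) (w : P.ι 0 → MvPolynomial σ k) :
    (coneD P Q f 0).mulVec (Sum.elim v w : Q.ι 1 ⊕ P.ι 0 → MvPolynomial σ k) =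
      (Q.d 0).mulVec v + (f 0).mulVec w :=
  Matrix.fromCols_mulVec_sumElim _ _ _ _

theorem coneD_succ_mulVec (f : ∀ i, Matrix (Q.ι i) (P.ι i) (MvPolynomial σ k)) (i : ℕ)
    (v : Q.ι (i + 2) → MvPolynomial σ k) (w : P.ι (i + 1) → MvPolynomial σ k) :
    (coneD P Q f (i + 1)).mulVec (Sum.elim v w : Q.ι (i + 2) ⊕ P.ι (i + 1) → MvPolynomial σ k) =
      (Sum.elim ((Q.d (i + 1)).mulVec v + (f (i + 1)).mulVec w) (-(P.d i).mulVec w) :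
        Q.ι (i + 1) ⊕ P.ι i → MvPolynomial σ k) := by
  refine (Matrix.fromBlocks_mulVec _ _ _ _ _).trans ?_
  simp [Matrix.neg_mulVec]

/-- Let (v, w) be a cycle of the cone. Then w is a cycle of P: in positive degrees by the lower
component, in degree 0 by `hcyc`, which encodes injectivity of p : S/I → S/J. So w = d w₁, the sum v
+ f w₁ is a cycle of Q and equals some d v', and (v', -w₁) maps to (v, w). -/
theorem exact_coneD (f : ∀ i, Matrix (Q.ι i) (P.ι i) (MvPolynomial σ k))
    (hfd : ∀ i, Q.d i * f (i + 1) = f i * P.d i)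
    (hcyc : ∀ w, Q.IsCycle 0 ((f 0).mulVec w) → P.IsCycle 0 w) :
    ∀ i v, (coneD P Q f i).mulVec v = 0 ↔ ∃ w, (coneD P Q f (i + 1)).mulVec w = v := by
  have hfd' : ∀ i w, (Q.d i).mulVec ((f (i + 1)).mulVec w) = (f i).mulVec ((P.d i).mulVec w) := by
    intro i w
    rw [Matrix.mulVec_mulVec, hfd, Matrix.mulVec_mulVec]
  have hdd : ∀ i v w, (Q.d i).mulVec ((Q.d (i + 1)).mulVec v + (f (i + 1)).mulVec w) +
      (f i).mulVec (-(P.d i).mulVec w) = 0 := by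
    intro i v w
    rw [Matrix.mulVec_add, hfd', Matrix.mulVec_neg, Matrix.mulVec_mulVec _ (Q.d i), Q.d_mul_d,
      Matrix.zero_mulVec, zero_add, add_neg_cancel]
  have hlift : ∀ i (v : Q.ι (i + 1) → MvPolynomial σ k) (w : P.ι i → MvPolynomial σ k),
      (Q.d i).mulVec v + (f i).mulVec w = 0 → P.IsCycle i w →
      ∃ (v' : Q.ι (i + 2) → MvPolynomial σ k) (w' : P.ι (i + 1) → MvPolynomial σ k),
        (Q.d (i + 1)).mulVec v' + (f (i + 1)).mulVec w' = v ∧ -(P.d i).mulVec w' = w := by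
    intro i v w h hw
    obtain ⟨w₁, rfl⟩ := (P.isCycle_iff i w).1 hw
    have : (Q.d i).mulVec (v + (f (i + 1)).mulVec w₁) = 0 := by
      rw [Matrix.mulVec_add, hfd', h]
    obtain ⟨v', hv'⟩ := (Q.exact_d i _).1 this
    exact ⟨v', -w₁, by rw [hv', Matrix.mulVec_neg, add_neg_cancel_right],
      by rw [Matrix.mulVec_neg, neg_neg]⟩
  intro i
  cases i with
  | zero =>
    intro (v : Q.ι 1 ⊕ P.ι 0 → MvPolynomial σ k)
    obtain ⟨v, w, rfl⟩ : ∃ a b, v = Sum.elim a b := ⟨_, _, (Sum.elim_comp_inl_inr v).symm⟩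
    rw [coneD_zero_mulVec]
    constructor
    · intro h
      obtain ⟨v', w', h1, h2⟩ := hlift 0 v w h (hcyc w ((Q.isCycle_iff 0 _).2
        ⟨-v, by rw [Matrix.mulVec_neg]; exact neg_eq_of_add_eq_zero_right h⟩))
      refine ⟨(Sum.elim v' w' : Q.ι 2 ⊕ P.ι 1 → MvPolynomial σ k), ?_⟩
      rw [coneD_succ_mulVec, ← h1, ← h2]
    · rintro ⟨u, hu⟩
      change Q.ι 2 ⊕ P.ι 1 → MvPolynomial σ k at u
      obtain ⟨v', w', rfl⟩ : ∃ a b, u = Sum.elim a b := ⟨_, _, (Sum.elim_comp_inl_inr u).symm⟩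
      rw [coneD_succ_mulVec] at hu
      obtain rfl : (Q.d (0 + 1)).mulVec v' + (f (0 + 1)).mulVec w' = v :=
        funext fun a => congrFun hu (Sum.inl a)
      obtain rfl : -(P.d (0)).mulVec w' = w := funext fun a => congrFun hu (Sum.inr a)
      exact hdd 0 v' w'
  | succ i =>
    intro (v : Q.ι (i + 2) ⊕ P.ι (i + 1) → MvPolynomial σ k)
    obtain ⟨v, w, rfl⟩ : ∃ a b, v = Sum.elim a b := ⟨_, _, (Sum.elim_comp_inl_inr v).symm⟩
    rw [coneD_succ_mulVec]
    constructor
    · intro h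
      have h1 : (Q.d (i + 1)).mulVec v + (f (i + 1)).mulVec w = 0 :=
        funext fun a => congrFun h (Sum.inl a)
      have h2 : (P.d i).mulVec w = 0 := neg_eq_zero.1 (funext fun a => congrFun h (Sum.inr a))
      obtain ⟨v', w', h1, h2⟩ := hlift (i + 1) v w h1 h2
      refine ⟨(Sum.elim v' w' : Q.ι (i + 3) ⊕ P.ι (i + 2) → MvPolynomial σ k), ?_⟩
      rw [coneD_succ_mulVec, ← h1, ← h2]
    · rintro ⟨u, hu⟩
      change Q.ι (i + 3) ⊕ P.ι (i + 2) → MvPolynomial σ k at u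
      obtain ⟨v', w', rfl⟩ : ∃ a b, u = Sum.elim a b := ⟨_, _, (Sum.elim_comp_inl_inr u).symm⟩
      rw [coneD_succ_mulVec] at hu
      obtain rfl : (Q.d (i + 2)).mulVec v' + (f (i + 2)).mulVec w' = v :=
        funext fun a => congrFun hu (Sum.inl a)
      obtain rfl : -(P.d (i + 1)).mulVec w' = w := funext fun a => congrFun hu (Sum.inr a)
      refine funext (Sum.rec (congrFun (hdd (i + 1) v' w')) fun a => ?_)
      have h : -(P.d i).mulVec (-(P.d (i + 1)).mulVec w') = 0 := by
        rw [Matrix.mulVec_neg, Matrix.mulVec_mulVec, P.d_mul_d, Matrix.zero_mulVec, neg_zero,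
          neg_zero]
      exact congrFun h a

/-- The mapping cone of a lift of the multiplication `p : S ⧸ (J : p) → S ⧸ J` to resolutions is a
resolution of `S ⧸ (J + (p))`. -/
noncomputable def cone (f : ∀ i, Matrix (Q.ι i) (P.ι i) (MvPolynomial σ k))
    {p : MvPolynomial σ k} {e : ℕ}
    (hf : ∀ i, IsHomogeneousMatrix (Q.deg i) (P.deg i) e (f i))
    (hfd : ∀ i, Q.d i * f (i + 1) = f i * P.d i)
    (hf0 : ∀ v, Q.aug ⬝ᵥ (f 0).mulVec v - p * P.aug ⬝ᵥ v ∈ J)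
    (hI : ∀ q, q ∈ I ↔ p * q ∈ J) (hK : ∀ q, q ∈ K ↔ ∃ c, q - p * c ∈ J) :
    GradedFreeResolution K where
  ι := coneIndex P Q
  fintype := inferInstance
  deg := coneDeg P Q e
  d := coneD P Q f
  aug := Q.aug
  homogeneous_d i := by
    cases i with
    | zero =>
      rintro a (b | b) m h
      · exact Q.homogeneous_d 0 a b m h
      · exact hf 0 a b m h
    | succ i =>
      rintro (a | a) (b | b) m h
      · exact Q.homogeneous_d (i + 1) a b m h
      · exact hf (i + 1) a b m h
      · exact absurd (coeff_zero m) h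
      · have h' : coeff m (-P.d i a b) ≠ 0 := h
        rw [coeff_neg, neg_ne_zero] at h'
        have := P.homogeneous_d i a b m h'
        change m.degree + (P.deg i a + e) = P.deg (i + 1) b + e + 0
        omega
  homogeneous_aug := Q.homogeneous_aug
  surjective_aug q := by
    obtain ⟨v, hv⟩ := Q.surjective_aug q
    exact ⟨v, (hK _).2 ⟨0, by rwa [mul_zero, sub_zero]⟩⟩
  exact_aug := by
    intro (v : Q.ι 0 → MvPolynomial σ k)
    refine (hK (Q.aug ⬝ᵥ v)).trans ?_
    constructor
    · rintro ⟨c, hc⟩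
      obtain ⟨w, hw⟩ := P.surjective_aug c
      -- Here `w` represents c only modulo I, which is harmless since p I ⊆ J.
      have h : Q.aug ⬝ᵥ (v - (f 0).mulVec w) ∈ J := by
        rw [dotProduct_sub]
        have := J.sub_mem (J.sub_mem hc (hf0 w)) ((hI _).1 hw)
        ring_nf at this ⊢
        exact this
      obtain ⟨u, hu⟩ := (Q.exact_aug _).1 h
      refine ⟨(Sum.elim u w : Q.ι 1 ⊕ P.ι 0 → MvPolynomial σ k), ?_⟩
      rw [coneD_zero_mulVec, hu, sub_add_cancel]
    · rintro ⟨u, rfl⟩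
      change Q.ι 1 ⊕ P.ι 0 → MvPolynomial σ k at u
      obtain ⟨v, w, rfl⟩ : ∃ a b, u = Sum.elim a b := ⟨_, _, (Sum.elim_comp_inl_inr u).symm⟩
      refine ⟨P.aug ⬝ᵥ w, ?_⟩
      have h : Q.aug ⬝ᵥ ((Q.d 0).mulVec v + (f 0).mulVec w) - p * P.aug ⬝ᵥ w ∈ J := by
        rw [dotProduct_add, add_sub_assoc]
        exact J.add_mem ((Q.exact_aug _).2 ⟨v, rfl⟩) (hf0 w)
      rwa [← coneD_zero_mulVec] at h
  exact_d := exact_coneD f hfd fun w hw =>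
    (hI _).2 ((J.sub_mem_iff_right hw).1 (hf0 w))

/-- A resolution of `S ⧸ (J : p)`, shifted by the degree of `p`, and one of `S ⧸ J` combine to a
resolution of `S ⧸ (J + (p))`. -/
theorem exists_cone (P : GradedFreeResolution I) (Q : GradedFreeResolution J)
    {p : MvPolynomial σ k} {e : ℕ} (hp : p.IsHomogeneous e)
    (hJ : ∀ q ∈ J, ∀ j, homogeneousComponent j q ∈ J)
    (hI : ∀ q, q ∈ I ↔ p * q ∈ J) (hK : ∀ q, q ∈ K ↔ ∃ c, q - p * c ∈ J) :
    ∃ R : GradedFreeResolution K,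
      (∀ N, (∀ i a, Q.deg i a ≤ N) → (∀ i a, P.deg i a + e ≤ N) → ∀ i a, R.deg i a ≤ N) ∧
      ∀ N, (∀ i a, Q.deg i a < N) → (∀ j, P.IsMinimalInDegree j) →
        R.IsMinimalInDegree N ∧ (Finset.univ.filter fun a => R.deg 0 a = N).card = 0 ∧
        ∀ i, (Finset.univ.filter fun a => R.deg (i + 1) a = N).card =
          (Finset.univ.filter fun a => P.deg i a + e = N).card := by
  obtain ⟨f, hf, hfd, hf0⟩ := exists_lift P Q hp (fun q hq => (hI q).1 hq) hJ
  refine ⟨cone f hf hfd hf0 hI hK, fun N hQ hP i => ?_, fun N hQ hP => ⟨fun i => ?_, ?_, ?_⟩⟩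
  · cases i with
    | zero => exact hQ 0
    | succ i =>
      rintro (a | a)
      · exact hQ (i + 1) a
      · exact hP i a
  · cases i with
    | zero => exact fun a b ha hb => absurd ha (hQ 0 a).ne
    | succ i =>
      rintro (a | a) (b | b) ha hb
      · exact absurd ha (hQ (i + 1) a).ne
      · exact absurd ha (hQ (i + 1) a).ne
      · exact absurd hb (hQ (i + 2) b).ne
      · have ha' : P.deg i a + e = N := ha
        have hb' : P.deg (i + 1) b + e = N := hb
        change constantCoeff (-P.d i a b) = 0
        -- Both basis elements have degree N - e in P; naming it `P.deg i a` avoids truncated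
        -- subtraction.
        rw [map_neg, hP (P.deg i a) i a b rfl (by omega), neg_zero]
  · rw [Finset.card_eq_zero, Finset.filter_eq_empty_iff]
    exact fun a _ => (hQ 0 a).ne
  · intro i
    symm
    refine Finset.card_bij (fun a _ => (Sum.inr a : Q.ι (i + 1) ⊕ P.ι i)) ?_ ?_ ?_
    · intro a ha
      exact Finset.mem_filter.2 ⟨Finset.mem_univ _, (Finset.mem_filter.1 ha).2⟩
    · intro a _ b _ h
      exact Sum.inr_injective h
    · rintro (b | b) hb
      · exact absurd (Finset.mem_filter.1 hb).2 (hQ (i + 1) b).ne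
      · exact ⟨b, Finset.mem_filter.2 ⟨Finset.mem_univ _, (Finset.mem_filter.1 hb).2⟩, rfl⟩

end Cone

/-! ### The base case and the passage from linear maps to matrices -/

section Conversion

variable {k : Type*} [Field k] {σ : Type*} {I : Ideal (MvPolynomial σ k)}

/-- The resolution of `S ⧸ 0` concentrated in homological degree `0`. -/
noncomputable def zeroIdeal : GradedFreeResolution (⊥ : Ideal (MvPolynomial σ k)) where
  ι i := match i with
    | 0 => Unit
    | _ + 1 => Empty
  fintype i := match i with
    | 0 => inferInstanceAs (Fintype Unit)
    | _ + 1 => inferInstanceAs (Fintype Empty)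
  deg _ _ := 0
  d _ := 0
  aug _ := 1
  homogeneous_d i a b m h := absurd (coeff_zero m) h
  homogeneous_aug a m h := by
    classical
    rw [coeff_one] at h
    have : 0 = m := by
      by_contra hm
      simp [hm] at h
    simp [← this]
  surjective_aug p := ⟨fun _ => p, by simp [dotProduct]⟩
  exact_aug v := by
    have h : (1 : MvPolynomial σ k) * v () = 0 ↔ v = 0 := by
      rw [one_mul]
      exact ⟨fun h => funext fun _ => h, fun h => congrFun h _⟩
    simp only [Ideal.mem_bot, Matrix.zero_mulVec, exists_const]
    rw [eq_comm (a := 0), ← h]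
    exact Eq.congr_left (Fintype.sum_unique _)
  exact_d i v := by
    have : v = 0 := funext fun a => a.elim
    simp [this]

/-- A minimal graded free resolution as a resolution described by matrices. -/
theorem _root_.FacetIdeals.MinimalGradedFreeResolution.exists_gradedFreeResolution
    (M : MinimalGradedFreeResolution I) :
    ∃ P : GradedFreeResolution I, (∀ j, P.IsMinimalInDegree j) ∧
      ∀ i j, (Finset.univ.filter fun a => P.deg i a = j).card =
        (Finset.univ.filter fun a => M.deg i a = j).card := by
  choose p hp hpM using M.homogeneous_aug
  have haug : ∀ v, M.aug v = Ideal.Quotient.mk I (p ⬝ᵥ v) := by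
    intro v
    have hv : v = ∑ b, v b • (Pi.single b 1 : Fin (M.rank 0) → MvPolynomial σ k) := by
      ext c; simp [Finset.sum_apply, Pi.single_apply]
    conv_lhs => rw [hv]
    rw [map_sum, dotProduct, map_sum]
    refine Finset.sum_congr rfl fun b _ => ?_
    rw [map_smul, hpM, map_mul, mul_comm, ← smul_eq_mul]
    rfl
  refine ⟨{
    ι := fun i => Fin (M.rank i)
    fintype := fun i => inferInstance
    deg := M.deg
    d := fun i => LinearMap.toMatrix' (M.d i)
    aug := p
    homogeneous_d := fun i a b m h => ?_
    homogeneous_aug := fun a m h => ?_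
    surjective_aug := fun q => ?_
    exact_aug := fun v => ?_
    exact_d := fun i v => ?_ }, fun j i a b _ _ => ?_, fun i j => rfl⟩
  · rw [LinearMap.toMatrix'_apply] at h
    exact M.homogeneous_d i b a m h
  · have := hp a h
    rw [add_zero, Finsupp.degree_eq_weight_one]
    exact this
  · obtain ⟨v, hv⟩ := M.surjective_aug (Ideal.Quotient.mk I q)
    exact ⟨v, Ideal.Quotient.eq.1 ((haug v).symm.trans hv)⟩
  · rw [← Ideal.Quotient.eq_zero_iff_mem, ← haug, M.exact_aug v]
    simp [LinearMap.toMatrix'_mulVec]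
  · simp only [LinearMap.toMatrix'_mulVec]
    exact M.exact_d i v
  · change constantCoeff (LinearMap.toMatrix' (M.d i) a b) = 0
    rw [LinearMap.toMatrix'_apply]
    exact M.minimal i _ a

end Conversion
end GradedFreeResolution
end FacetIdeals

namespace FacetIdeals

/-! ### Square-free monomial ideals, their colon ideals and degree bounds -/

section SquarefreeIdeals

variable (k : Type*) [Field k] {σ : Type*}

/-- The ideal generated by the square-free monomials with supports in `𝒢`. -/
noncomputable def squarefreeIdeal (𝒢 : Set (Finset σ)) : Ideal (MvPolynomial σ k) :=
  Ideal.span {p | ∃ G ∈ 𝒢, p = ∏ x ∈ G, X x}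

variable {k}

theorem prod_X_eq_monomial (G : Finset σ) :
    (∏ x ∈ G, X x : MvPolynomial σ k) = monomial (∑ x ∈ G, Finsupp.single x 1) 1 := by
  rw [monomial_sum_one]
  rfl

theorem sum_single_apply [DecidableEq σ] (G : Finset σ) (y : σ) :
    (∑ x ∈ G, Finsupp.single x 1 : σ →₀ ℕ) y = if y ∈ G then 1 else 0 := by
  simp [Finsupp.finsetSum_apply, Finsupp.single_apply]

/-- Membership in a monomial ideal is tested on each monomial, and divisibility by a square-free
monomial depends only on supports. -/
theorem mem_squarefreeIdeal {𝒢 : Set (Finset σ)} {p : MvPolynomial σ k} :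
    p ∈ squarefreeIdeal k 𝒢 ↔ ∀ m, coeff m p ≠ 0 → ∃ G ∈ 𝒢, ∀ x ∈ G, m x ≠ 0 := by
  classical
  have h : {p : MvPolynomial σ k | ∃ G ∈ 𝒢, p = ∏ x ∈ G, X x} =
      (fun s => monomial s 1) '' ((fun G : Finset σ => ∑ x ∈ G, Finsupp.single x 1) '' 𝒢) := by
    ext p
    simp [prod_X_eq_monomial, eq_comm]
  rw [squarefreeIdeal, h, mem_ideal_span_monomial_image]
  refine forall_congr' fun m => ?_
  rw [mem_support_iff]
  refine imp_congr_right fun _ => ?_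
  rw [Set.exists_mem_image]
  refine exists_congr fun G => and_congr_right fun _ => ?_
  rw [Finsupp.le_def]
  refine forall_congr' fun x => ?_
  rw [sum_single_apply]
  split_ifs with hx <;> simp [hx, Nat.one_le_iff_ne_zero]

theorem homogeneousComponent_mem_squarefreeIdeal {𝒢 : Set (Finset σ)} :
    ∀ p ∈ squarefreeIdeal k 𝒢, ∀ j, homogeneousComponent j p ∈ squarefreeIdeal k 𝒢 := by
  classical
  intro p hp j
  rw [mem_squarefreeIdeal] at hp ⊢
  intro m hm
  rw [coeff_homogeneousComponent] at hm
  exact hp m fun h => hm (by simp [h])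

/-- The colon ideal by the monomial of F: multiplication by it makes all exponents on F positive, so
divisibility by the monomial of G is a condition on G ∖ F alone. -/
theorem mem_squarefreeIdeal_sdiff [DecidableEq σ] {𝒢 : Set (Finset σ)} (F : Finset σ)
    (p : MvPolynomial σ k) :
    p ∈ squarefreeIdeal k ((· \ F) '' 𝒢) ↔ (∏ x ∈ F, X x) * p ∈ squarefreeIdeal k 𝒢 := by
  rw [mem_squarefreeIdeal, mem_squarefreeIdeal, prod_X_eq_monomial]
  set s : σ →₀ ℕ := ∑ x ∈ F, Finsupp.single x 1 with hs
  have key : ∀ (m : σ →₀ ℕ) (G : Finset σ),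
      (∀ x ∈ G \ F, m x ≠ 0) ↔ ∀ x ∈ G, (s + m) x ≠ 0 := by
    intro m G
    refine forall_congr' fun x => ?_
    rw [Finsupp.add_apply, hs, sum_single_apply, Finset.mem_sdiff]
    by_cases hx : x ∈ F <;> simp [hx]
  have hco : ∀ m, coeff m (monomial s 1 * p) = if s ≤ m then coeff (m - s) p else 0 := by
    intro m
    rw [coeff_monomial_mul', one_mul]
  constructor
  · intro h m hm
    rw [hco] at hm
    split_ifs at hm with hsm
    · obtain ⟨_, ⟨G, hG, rfl⟩, hx⟩ := h _ hm
      refine ⟨G, hG, ?_⟩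
      have := (key _ G).1 hx
      rwa [add_tsub_cancel_of_le hsm] at this
    · exact absurd rfl hm
  · intro h m hm
    obtain ⟨G, hG, hx⟩ := h (s + m) (by rw [hco, if_pos le_self_add, add_tsub_cancel_left]; exact hm)
    exact ⟨_, ⟨G, hG, rfl⟩, (key m G).2 hx⟩

theorem mem_squarefreeIdeal_insert {𝒢 : Set (Finset σ)} (F : Finset σ) (p : MvPolynomial σ k) :
    p ∈ squarefreeIdeal k (insert F 𝒢) ↔
      ∃ c, p - (∏ x ∈ F, X x) * c ∈ squarefreeIdeal k 𝒢 := by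
  have h : {p : MvPolynomial σ k | ∃ G ∈ insert F 𝒢, p = ∏ x ∈ G, X x} =
      insert (∏ x ∈ F, X x) {p | ∃ G ∈ 𝒢, p = ∏ x ∈ G, X x} := by
    ext p
    simp
  rw [squarefreeIdeal, h, Ideal.span_insert, Ideal.mem_span_singleton_sup]
  constructor
  · rintro ⟨a, b, hb, rfl⟩
    exact ⟨a, by rw [mul_comm, add_sub_cancel_left]; exact hb⟩
  · rintro ⟨c, hc⟩
    exact ⟨c, _, hc, by ring⟩

theorem isHomogeneous_prod_X (F : Finset σ) :
    (∏ x ∈ F, X x : MvPolynomial σ k).IsHomogeneous F.card := by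
  simpa using IsHomogeneous.prod F (fun x => (X x : MvPolynomial σ k)) (fun _ => 1)
    fun x _ => isHomogeneous_X k x

/-- A square-free monomial ideal in the variables `U` has a resolution without basis elements of
degree greater than `|U|`. -/
theorem exists_resolution_deg_le [DecidableEq σ] (N : ℕ) (𝒢 : Finset (Finset σ))
    (h𝒢 : 𝒢.card ≤ N) (U : Finset σ) (hU : ∀ G ∈ 𝒢, G ⊆ U) :
    ∃ P : GradedFreeResolution (squarefreeIdeal k (𝒢 : Set (Finset σ))),
      ∀ i a, P.deg i a ≤ U.card := by
  induction N generalizing 𝒢 U with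
  | zero =>
    have h : squarefreeIdeal k ((𝒢 : Finset (Finset σ)) : Set (Finset σ)) = ⊥ := by
      rw [Finset.card_eq_zero.1 (Nat.le_zero.1 h𝒢), squarefreeIdeal]
      simp
    rw [h]
    exact ⟨GradedFreeResolution.zeroIdeal, fun _ _ => Nat.zero_le _⟩
  | succ N ih =>
    obtain h | ⟨F, hF⟩ := 𝒢.eq_empty_or_nonempty
    · exact ih 𝒢 (by simp [h]) U hU
    have hcard : (𝒢.erase F).card ≤ N := by
      rw [Finset.card_erase_of_mem hF]
      omega
    obtain ⟨Q, hQ⟩ := ih (𝒢.erase F) hcard U fun G hG => hU G (Finset.mem_of_mem_erase hG)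
    -- The colon ideal uses only the variables U ∖ F, so its degree bound |U| - |F| becomes |U|
    -- after the shift by |F|. Distinct G may have equal G ∖ F; this is why the induction bounds the
    -- number of generators by N.
    obtain ⟨P, hP⟩ := ih ((𝒢.erase F).image (· \ F)) (Finset.card_image_le.trans hcard) (U \ F) (by
      refine Finset.forall_mem_image.2 fun G hG => ?_
      exact Finset.sdiff_subset_sdiff (hU G (Finset.mem_of_mem_erase hG)) le_rfl)
    obtain ⟨R, hR, -⟩ := GradedFreeResolution.exists_cone
      (K := squarefreeIdeal k ((𝒢 : Finset (Finset σ)) : Set (Finset σ))) P Q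
      (isHomogeneous_prod_X F) homogeneousComponent_mem_squarefreeIdeal
      (fun q => by rw [Finset.coe_image]; exact mem_squarefreeIdeal_sdiff F q)
      (fun q => by
        rw [← mem_squarefreeIdeal_insert, ← Finset.coe_insert, Finset.insert_erase hF])
    refine ⟨R, hR _ hQ fun i a => ?_⟩
    have := Finset.card_sdiff_add_card_eq_card (hU F hF)
    have := hP i a
    omega

end SquarefreeIdeals

/-! ### Facets and facet ideals of the derived complexes -/

namespace SimplicialComplex

variable {σ : Type*}

theorem facets_removeFacet (Δ : SimplicialComplex σ) (F : Finset σ) :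
    (Δ.removeFacet F).facets = Δ.facets \ {F} := by
  ext G
  constructor
  · intro hG
    obtain ⟨H, hH, hGH⟩ := mem_lowerClosure.1 hG.1
    have hHG : H ≤ G := hG.2 (mem_lowerClosure.2 ⟨H, hH, le_rfl⟩) hGH
    rwa [le_antisymm hGH hHG]
  · intro hG
    refine ⟨mem_lowerClosure.2 ⟨G, hG, le_rfl⟩, fun H hH hle => ?_⟩
    obtain ⟨H', hH', hle'⟩ := mem_lowerClosure.1 hH
    exact hle'.trans (hG.1.2 hH'.1.1 (hle.trans hle'))

theorem facet_subset_vertices [Fintype σ] {Δ : SimplicialComplex σ} {G : Finset σ}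
    (hG : G ∈ Δ.facets) : G ⊆ Δ.vertices := by
  intro x hx
  simp only [vertices, Finset.mem_filter, Finset.mem_univ, true_and]
  exact Δ.lower (Finset.singleton_subset_iff.2 hx) hG.1

/-- The facet ideal of the localization `Δ_U` is generated by the monomials with supports
`G ∩ U`, `G` a facet of `Δ`. -/
theorem facetIdeal_localize [Finite σ] [DecidableEq σ] (k : Type*) [Field k]
    (Δ : SimplicialComplex σ) (U : Finset σ) :
    (Δ.localize U).facetIdeal k = squarefreeIdeal k ((· ∩ U) '' Δ.facets) := by
  have h : (Δ.localize U).facetIdeal k = squarefreeIdeal k (Δ.localize U).facets := rfl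
  ext p
  rw [h, facets_localize, mem_squarefreeIdeal, mem_squarefreeIdeal]
  refine forall₂_congr fun m _ => ⟨?_, ?_⟩
  · rintro ⟨B, hB, hm⟩
    obtain ⟨G, hG, rfl⟩ := hB.1
    exact ⟨_, ⟨G, hG, rfl⟩, hm⟩
  · rintro ⟨_, ⟨G, hG, rfl⟩, hm⟩
    -- Non-minimal sets G ∩ U give redundant generators.
    obtain ⟨B, hBG, hB⟩ := (Set.toFinite {A | ∃ G ∈ Δ.facets, A = G ∩ U}).exists_le_minimal
      (⟨G, hG, rfl⟩ : G ∩ U ∈ {A | ∃ G ∈ Δ.facets, A = G ∩ U})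
    exact ⟨B, hB, fun x hx => hm x (hBG hx)⟩

end SimplicialComplex

end FacetIdeals

/-! ### The theorem -/

open FacetIdeals SimplicialComplex GradedFreeResolution in
theorem propositionp {k : Type*} [Field k] {σ : Type*} [Fintype σ] [DecidableEq σ]
    (Δ : FacetIdeals.SimplicialComplex σ) (n : ℕ) (hn : Δ.vertices.card = n)
    (F : Finset σ) (hF : F ∈ Δ.facets) (hfree : ∃ v, Δ.IsFreeVertex F v)
    (Γ : FacetIdeals.SimplicialComplex σ)
    (hΓ : Γ = (Δ.removeFacet F).localize (Δ.vertices \ F)) (i : ℤ) :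
    Δ.betti k i n = Γ.betti k (i - 1) ((n : ℤ) - F.card) := by
  obtain ⟨v, hvF, hv⟩ := hfree
  have hΓI : Γ.facetIdeal k = squarefreeIdeal k ((· \ F) '' (Δ.facets \ {F})) := by
    rw [hΓ, facetIdeal_localize, facets_removeFacet]
    congr 1
    refine Set.image_congr fun G hG => ?_
    rw [← Finset.inter_sdiff_assoc, Finset.inter_eq_left.2 (facet_subset_vertices hG.1)]
  obtain ⟨𝒢, h𝒢⟩ := (Set.toFinite (Δ.facets \ {F})).exists_finset_coe
  -- Freeness of v enters here: no facet other than F contains v, so the degrees in Q are at most n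
  -- - 1.
  obtain ⟨Q, hQ⟩ := exists_resolution_deg_le (k := k) _ 𝒢 le_rfl (Δ.vertices.erase v) (by
    intro G hG
    obtain ⟨hG, hne⟩ : G ∈ Δ.facets \ {F} := h𝒢 ▸ Finset.mem_coe.2 hG
    exact Finset.subset_erase.2 ⟨facet_subset_vertices hG, hv G hG hne⟩)
  rw [← h𝒢] at hΓI
  have hQn : ∀ i a, Q.deg i a < n := by
    intro i a
    have h := hQ i a
    have hvV := facet_subset_vertices hF hvF
    rw [Finset.card_erase_of_mem hvV] at h
    have := Finset.card_pos.2 ⟨v, hvV⟩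
    omega
  obtain ⟨M, hM, hMc⟩ := (Classical.choice
    (Δ.nonempty_resolution_facetIdeal k)).exists_gradedFreeResolution
  obtain ⟨P, hP, hPc⟩ := (Classical.choice
    (Γ.nonempty_resolution_facetIdeal k)).exists_gradedFreeResolution
  obtain ⟨R, -, hR⟩ := exists_cone (K := Δ.facetIdeal k) P Q (isHomogeneous_prod_X F)
    homogeneousComponent_mem_squarefreeIdeal
    (fun q => by rw [hΓI]; exact mem_squarefreeIdeal_sdiff F q)
    (fun q => by
      rw [← mem_squarefreeIdeal_insert, h𝒢, Set.insert_sdiff_singleton, Set.insert_eq_of_mem hF]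
      rfl)
  obtain ⟨hRmin, hR0, hRs⟩ := hR n hQn hP
  have hMR : ∀ i, (Finset.univ.filter fun a => M.deg i a = n).card =
      (Finset.univ.filter fun a => R.deg i a = n).card := fun i =>
    le_antisymm (M.card_le_card R (hM n) homogeneousComponent_mem_squarefreeIdeal i)
      (R.card_le_card M hRmin homogeneousComponent_mem_squarefreeIdeal i)
  unfold betti MinimalGradedFreeResolution.betti
  by_cases hi : 0 ≤ i
  · lift i to ℕ using hi
    rw [if_pos (Int.natCast_nonneg i)]
    simp only [Int.toNat_natCast, Nat.cast_inj]
    rw [← hMc, hMR]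
    cases i with
    -- Both sides vanish: the cone has only Q in homological degree 0, and the other index is -1.
    | zero => rw [hR0, if_neg (by simp)]
    | succ i =>
      have h1 : ((i + 1 : ℕ) : ℤ) - 1 = i := by simp
      rw [hRs, h1, if_pos (Int.natCast_nonneg i), Int.toNat_natCast]
      have hFn : F.card ≤ n := hn ▸ Finset.card_le_card (facet_subset_vertices hF)
      have h2 : ∀ d : ℕ, ((d : ℤ) = n - F.card) ↔ d = n - F.card := by omega
      have h3 : ∀ d : ℕ, d + F.card = n ↔ d = n - F.card := by omega
      simp only [h2, h3]
      exact hPc i _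
  · rw [if_neg hi, if_neg (by omega)]
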